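/- **Setting.** Two agents $i\in\{1,2\}$ with budgets $B_1\ge 0$, $B_2>0$ take part in $k\ge 0$ successive first-price sealed-bid auctions of one item each. Agent $i$ has value $v_i$ per item, where $v_i>2^kB_j$ for all $i,j\in\{1,2\}$. Besides a bid $b$ an agent may submit a bid $b+$, which beats $b$, loses to every bid $b'>b$, and is charged $b$. In each round the higher bid wins and the winner pays the amount of her bid out of her budget; equal bids are resolved uniformly at random. The final utility of agent $i$ is $v_i$ times the number of items she won plus her remaining budget. **Canonical outcome.** It is defined by recursion on the number of items. For $0$ items nothing happens. Let $U^{(k-1)}_i(B_i,B_{-i})$ be the expected utility of agent $i$ in the canonical outcome with $k-1$ items and budgets $B_i$ (her own) and $B_{-i}$ (the other agent's). For $0\le p\le B_i$ put $$W_i(p)=v_i+U^{(k-1)}_i(B_i-p,\,B_{-i}),\qquad L_i(p)=U^{(k-1)}_i\bigl(B_i,\,\max(B_{-i}-p,0)\bigr).$$ The critical price of agent $i$ is the $p_i\in[0,B_i]$ such that $W_i(p)>L_i(p)$ for $p\in[0,p_i)$ and $W_i(p)<L_i(p)$ for $p\in(p_i,B_i]$; in general put $p_i=\sup\{p\in[0,B_i]: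 W_i(p)>L_i(p)\}$ (with $\sup\emptyset=0$), which agrees with this. In the first round of the canonical outcome with $k$ items, if $p_i>p_{-i}$ then agent $i$ bids $p_{-i}+$ and agent $-i$ bids $p_{-i}$; if $p_1=p_2$ then both bid this price. The play then continues with the canonical outcome for $k-1$ items and the resulting budgets. **Proposition.** Let $k_1,k_2\in\mathbb Z_{\ge0}$ with $k_1+k_2=k$ and $\frac{B_1}{B_2}=\frac{k_1}{k_2+1}$, and let $p^*=\frac{B_2}{k_2+1}$, so that $p^*=\frac{B_1}{k_1}$ if $k_1\ne0$. Then every play of $k$ rounds that occurs with positive probability in the canonical outcome has the following form: as long as both agents have a positive remaining budget, both bid exactly $p^*$; this goes on until, after some number $m\le k$ of rounds, one agent has remaining budget $0$; and all items in the remaining $k-m$ rounds are won by the other agent at price $0$. -/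

import Mathlib

namespace SeqAuction

/-- The opponent of agent `i`. Agents 1 and 2 are the elements `0` and `1` of `Fin 2`. -/
def other (i : Fin 2) : Fin 2 := 1 - i

/-- A bid: `⟨b, false⟩` is the bid `b`, and `⟨b, true⟩` is the bid `b+`, which is
infinitesimally larger than `b` but is charged `b`. -/
@[ext] structure Bid where
  amount : ℝ
  plus : Bool

/-- `c` is a higher bid than `b`. -/
def Bid.Beaten (b c : Bid) : Prop :=
  b.amount < c.amount ∨ (b.amount = c.amount ∧ b.plus = false ∧ c.plus = true)

/-- One round of the auction as it was played: the two bids, and who got the item. -/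
structure Round where
  bids : Fin 2 → Bid
  winner : Fin 2

/-- First-price rule: the winner is charged the amount of her own bid. -/
def Round.price (r : Round) : ℝ := (r.bids r.winner).amount

/-- The budgets after agent `w` has won an item at price `p`. -/
def pay (B : Fin 2 → ℝ) (w : Fin 2) (p : ℝ) : Fin 2 → ℝ :=
  Function.update B w (B w - p)

/-- The budgets that remain after the rounds listed in `h` (in the order of play) have been
played from the initial budgets `B`. -/
def remaining (B : Fin 2 → ℝ) (h : List Round) : Fin 2 → ℝ :=
  h.foldl (fun C r => pay C r.winner r.price) B

/-- The final utility of agent `i`: the value of the items she won plus her remaining budget. -/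
def payoff (v B : Fin 2 → ℝ) (h : List Round) (i : Fin 2) : ℝ :=
  v i * (h.countP (fun r => r.winner = i) : ℝ) + remaining B h i

open scoped Classical in
/-- The law of the winner of a round: the higher bid wins, and equal bids are resolved
uniformly at random. -/
noncomputable def winnerLaw (b : Fin 2 → Bid) : PMF (Fin 2) :=
  if (b 1).Beaten (b 0) then PMF.pure 0
  else if (b 0).Beaten (b 1) then PMF.pure 1
  else PMF.uniformOfFintype (Fin 2)

/-- The expected utility of agent `i`, with initial budgets `B`, under the law `P` of the play. -/
noncomputable def expectedUtility (v B : Fin 2 → ℝ) (P : PMF (List Round)) (i : Fin 2) : ℝ :=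
  ∑' h, (P h).toReal * payoff v B h i

section Critical

variable (v : Fin 2 → ℝ) (U : (Fin 2 → ℝ) → Fin 2 → ℝ) (B : Fin 2 → ℝ) (i : Fin 2)

/-- Winning utility of agent `i` at price `p`, where `U B' j` is the utility of agent `j` in the
canonical outcome of the remaining auction when the budgets are `B'`. -/
def winUtility (p : ℝ) : ℝ := v i + U (pay B i p) i

/-- Losing utility of agent `i` at price `p`: the opponent wins the item and pays `p`. A price
above the opponent's budget is treated as exhausting that budget. -/
noncomputable def loseUtility (p : ℝ) : ℝ :=
  U (Function.update B (other i) (max (B (other i) - p) 0)) i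

/-- `c` is a critical price of agent `i`: among the prices `p ∈ [0, B i]` that she can pay, she
strictly prefers winning below `c` and strictly prefers losing above `c`. (If she prefers winning
at all prices she can pay, the critical price is `B i`.) -/
def IsCriticalPrice (c : ℝ) : Prop :=
  c ∈ Set.Icc 0 (B i) ∧ ∀ p ∈ Set.Icc 0 (B i),
    (p < c → loseUtility U B i p < winUtility v U B i p) ∧
    (c < p → winUtility v U B i p < loseUtility U B i p)

/-- The critical price of agent `i`. By `critPrice_eq` below it is the unique number with the
property `IsCriticalPrice` whenever such a number exists. -/
noncomputable def critPrice : ℝ :=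
  sSup {p : ℝ | p ∈ Set.Icc 0 (B i) ∧ loseUtility U B i p < winUtility v U B i p}

theorem critPrice_eq {c : ℝ} (hc : IsCriticalPrice v U B i c) : critPrice v U B i = c := by
  obtain ⟨⟨h0, h1⟩, h⟩ := hc
  have hub : ∀ p ∈ {p : ℝ | p ∈ Set.Icc 0 (B i) ∧
      loseUtility U B i p < winUtility v U B i p}, p ≤ c := by
    rintro p ⟨hp, hlt⟩
    by_contra hcp
    exact lt_asymm hlt ((h p hp).2 (not_le.1 hcp))
  refine le_antisymm (Real.sSup_le hub h0) ?_
  by_contra hlt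
  rw [not_le] at hlt
  have hs : 0 ≤ critPrice v U B i := Real.sSup_nonneg fun p hp => hp.1.1
  obtain ⟨q, hq1, hq2⟩ := exists_between hlt
  have hq : q ∈ Set.Icc 0 (B i) := ⟨by linarith, by linarith⟩
  have : q ≤ critPrice v U B i := le_csSup ⟨c, hub⟩ ⟨hq, (h q hq).1 hq2⟩
  linarith

end Critical

open scoped Classical in
/-- The bids of the canonical outcome in a round in which the critical prices are `c`: the agent
with the strictly higher critical price bids the other one's critical price `+`, everybody else
bids her own critical price. -/
noncomputable def canonicalBids (c : Fin 2 → ℝ) (i : Fin 2) : Bid :=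
  if c (other i) < c i then ⟨c (other i), true⟩ else ⟨c i, false⟩

/-- The canonical outcome of the sequential auction of `k` items with values `v` and budgets `B`,
as the law of the play (the list of the rounds, in the order of play). -/
noncomputable def canonicalOutcome (v : Fin 2 → ℝ) : ℕ → (Fin 2 → ℝ) → PMF (List Round)
  | 0, _ => PMF.pure []
  | k + 1, B =>
    let U := fun B' => expectedUtility v B' (canonicalOutcome v k B')
    let b := canonicalBids (critPrice v U B)
    (winnerLaw b).bind fun w =>
      (canonicalOutcome v k (pay B w (b w).amount)).map (List.cons ⟨b, w⟩)

end SeqAuction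

namespace SeqAuction

/-! ### Agents, plays and payoffs -/

/-! Every budget stays below its owner's value, so an extra item outweighs any amount of money, and
bidding is governed first by how many items the budgets guarantee. With own budget x and opposing
budget y, an agent is guaranteed a of a + b items when a y < (b + 1) x (`Secures`). These regions
are separated by walls: for k + 1 items, the budget pairs ((a + 1) s, (b + 1) s) with a + b = k
(`interior_or_ratio`).

On a wall the price s is critical for both agents (`crit_of_ratio`): below s winning leads to more
items in total than losing, above s losing is better. Whoever pays s, the budgets remain integer
multiples of s whose sum, in units of s, is one more than the number of items left. So the argument
repeats until one budget is 0, at the latest when no item is left; after that the other agent wins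
everything for free (`SweepsExhausted`). This gives `plays_of_ratio`.

The hard part is that the canonical outcome delivers the guaranteed items (`PlayBounds.wins_ge`).
Between walls, winning and losing the current item may lead to the same total, and then leftover
money decides the critical price. The induction therefore also carries the estimate v a + c e ≤
payoff ≤ v a + C e, where e = (b + 1) x - a y is the excess over the lower wall. It confines the
critical prices to a range in which no payment carries either agent across a wall (`win_bounds`).
The constants deteriorate with k, but only their positivity matters. -/

@[simp] theorem other_other (i : Fin 2) : other (other i) = i := by
  fin_cases i <;> rfl

theorem other_ne (i : Fin 2) : other i ≠ i := by
  fin_cases i <;> decide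

theorem eq_or_eq_other (w i : Fin 2) : w = i ∨ w = other i := by
  fin_cases w <;> fin_cases i <;> decide

@[simp] theorem pay_self (B : Fin 2 → ℝ) (i : Fin 2) (p : ℝ) : pay B i p i = B i - p := by
  simp [pay]

@[simp] theorem pay_other (B : Fin 2 → ℝ) (i : Fin 2) (p : ℝ) :
    pay B i p (other i) = B (other i) := by
  simp [pay, other_ne]

@[simp] theorem pay_other_self (B : Fin 2 → ℝ) (i : Fin 2) (p : ℝ) :
    pay B (other i) p i = B i := by
  simp [pay, (other_ne i).symm]

/-- The number of items that agent `i` wins in the play `h`. -/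
def wins (h : List Round) (i : Fin 2) : ℕ := h.countP (fun r => r.winner = i)

theorem wins_cons_self (r : Round) (h : List Round) :
    wins (r :: h) r.winner = wins h r.winner + 1 := by
  simp [wins]

theorem wins_cons_other (r : Round) (h : List Round) :
    wins (r :: h) (other r.winner) = wins h (other r.winner) := by
  simp [wins, (other_ne r.winner).symm]

theorem remaining_cons (B : Fin 2 → ℝ) (r : Round) (h : List Round) :
    remaining B (r :: h) = remaining (pay B r.winner r.price) h := rfl

theorem payoff_eq (v B : Fin 2 → ℝ) (h : List Round) (i : Fin 2) :
    payoff v B h i = v i * (wins h i : ℝ) + remaining B h i := rfl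

theorem payoff_cons_self (v B : Fin 2 → ℝ) (r : Round) (h : List Round) :
    payoff v B (r :: h) r.winner =
      v r.winner + payoff v (pay B r.winner r.price) h r.winner := by
  rw [payoff_eq, payoff_eq, wins_cons_self, remaining_cons]
  push_cast
  ring

theorem payoff_cons_other (v B : Fin 2 → ℝ) (r : Round) (h : List Round) :
    payoff v B (r :: h) (other r.winner) =
      payoff v (pay B r.winner r.price) h (other r.winner) := by
  rw [payoff_eq, payoff_eq, wins_cons_other, remaining_cons]

/-! ### The law of the canonical outcome -/

/-- The utility of agent `i` in the canonical outcome of `k` items with budgets `B`. -/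
noncomputable def util (v : Fin 2 → ℝ) (k : ℕ) (B : Fin 2 → ℝ) (i : Fin 2) : ℝ :=
  expectedUtility v B (canonicalOutcome v k B) i

/-- The critical price of agent `i` in the first round when `k + 1` items are for sale. -/
noncomputable def crit (v : Fin 2 → ℝ) (k : ℕ) (B : Fin 2 → ℝ) (i : Fin 2) : ℝ :=
  critPrice v (util v k) B i

/-- A strictly lower critical price is bid without plus and loses to the same amount with plus. In a
tie the two prices coincide, so in every case the winner is charged the loser's critical price. -/
theorem winner_spec (c : Fin 2 → ℝ) (w : Fin 2)
    (hw : w ∈ (winnerLaw (canonicalBids c)).support) :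
    c (other w) ≤ c w ∧ (canonicalBids c w).amount = c (other w) := by
  have key : c (other w) ≤ c w := by
    by_contra hlt
    rw [not_le] at hlt
    have h1 : canonicalBids c w = ⟨c w, false⟩ := by simp [canonicalBids, hlt.le]
    have h2 : canonicalBids c (other w) = ⟨c w, true⟩ := by simp [canonicalBids, hlt]
    have hb : (canonicalBids c w).Beaten (canonicalBids c (other w)) := by
      rw [h1, h2]; simp [Bid.Beaten]
    have hn : ¬ (canonicalBids c (other w)).Beaten (canonicalBids c w) := by
      rw [h1, h2]; simp [Bid.Beaten]
    fin_cases w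
    · change (canonicalBids c 0).Beaten (canonicalBids c 1) at hb
      change ¬ (canonicalBids c 1).Beaten (canonicalBids c 0) at hn
      simp [winnerLaw, hb, hn] at hw
    · change (canonicalBids c 1).Beaten (canonicalBids c 0) at hb
      simp [winnerLaw, hb] at hw
  refine ⟨key, ?_⟩
  rcases key.lt_or_eq with h | h
  · simp [canonicalBids, h]
  · simp [canonicalBids, h]

theorem mem_support_succ {v : Fin 2 → ℝ} {k : ℕ} {B : Fin 2 → ℝ} {h : List Round}
    (hh : h ∈ (canonicalOutcome v (k + 1) B).support) :
    ∃ r h', h = r :: h' ∧ r.bids = canonicalBids (crit v k B) ∧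
      r.price = crit v k B (other r.winner) ∧
      crit v k B (other r.winner) ≤ crit v k B r.winner ∧
      h' ∈ (canonicalOutcome v k (pay B r.winner r.price)).support := by
  rw [canonicalOutcome] at hh
  simp only [PMF.mem_support_bind_iff, PMF.mem_support_map_iff] at hh
  obtain ⟨w, hw, h', hh', rfl⟩ := hh
  obtain ⟨h1, h2⟩ := winner_spec _ w hw
  exact ⟨⟨_, w⟩, h', rfl, rfl, h2, h1, hh'⟩

/-- Budgets that are nonnegative and smaller than the respective values. -/
def Admissible (v B : Fin 2 → ℝ) : Prop := ∀ i, 0 ≤ B i ∧ B i < v i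

theorem Admissible.of_agents {v B : Fin 2 → ℝ} (i : Fin 2) (h1 : 0 ≤ B i ∧ B i < v i)
    (h2 : 0 ≤ B (other i) ∧ B (other i) < v (other i)) : Admissible v B := by
  intro j
  rcases eq_or_eq_other j i with rfl | rfl <;> assumption

theorem Admissible.pay {v B : Fin 2 → ℝ} (hB : Admissible v B) {i : Fin 2} {p : ℝ}
    (h0 : 0 ≤ p) (h1 : p ≤ B i) : Admissible v (pay B i p) := by
  have h2 := hB i
  refine .of_agents i ?_ ?_
  · rw [pay_self]; constructor <;> linarith
  · rw [pay_other]; exact hB _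

theorem crit_nonneg (v : Fin 2 → ℝ) (k : ℕ) (B : Fin 2 → ℝ) (i : Fin 2) : 0 ≤ crit v k B i :=
  Real.sSup_nonneg fun _ hp => hp.1.1

/-- The budgets after the opponent of agent `i` has won an item at price `p`, where a price above
her budget exhausts it. -/
noncomputable def lose (B : Fin 2 → ℝ) (i : Fin 2) (p : ℝ) : Fin 2 → ℝ :=
  Function.update B (other i) (max (B (other i) - p) 0)

@[simp] theorem lose_self (B : Fin 2 → ℝ) (i : Fin 2) (p : ℝ) : lose B i p i = B i := by
  simp [lose, (other_ne i).symm]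

@[simp] theorem lose_other (B : Fin 2 → ℝ) (i : Fin 2) (p : ℝ) :
    lose B i p (other i) = max (B (other i) - p) 0 := by
  simp [lose]

theorem Admissible.lose {v B : Fin 2 → ℝ} (hB : Admissible v B) {i : Fin 2} {p : ℝ}
    (h0 : 0 ≤ p) : Admissible v (lose B i p) := by
  have h2 := hB (other i)
  refine .of_agents i ?_ ?_
  · rw [lose_self]; exact hB i
  · rw [lose_other]
    exact ⟨le_max_right _ _, max_lt (by linarith) (by linarith)⟩

/-! ### One-sided estimates of critical prices -/

theorem crit_le {v : Fin 2 → ℝ} {k : ℕ} {B : Fin 2 → ℝ} {i : Fin 2} {c : ℝ} (hc : 0 ≤ c)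
    (H : ∀ p, 0 ≤ p → p ≤ B i → c < p → v i + util v k (pay B i p) i ≤ util v k (lose B i p) i) :
    crit v k B i ≤ c := by
  refine Real.sSup_le ?_ hc
  rintro p ⟨⟨h0, h1⟩, h2⟩
  by_contra hlt
  exact absurd h2 (not_lt.2 (H p h0 h1 (not_le.1 hlt)))

theorem crit_le_budget {v : Fin 2 → ℝ} {k : ℕ} {B : Fin 2 → ℝ} {i : Fin 2} (hB : 0 ≤ B i) :
    crit v k B i ≤ B i :=
  Real.sSup_le (fun _ hp => hp.1.2) hB

/-- The critical price is a supremum, so a single price at which winning is strictly better bounds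
it below; no monotonicity in the price is needed. -/
theorem le_crit {v : Fin 2 → ℝ} {k : ℕ} {B : Fin 2 → ℝ} {i : Fin 2} {p : ℝ}
    (h0 : 0 ≤ p) (h1 : p ≤ B i)
    (H : util v k (lose B i p) i < v i + util v k (pay B i p) i) : p ≤ crit v k B i :=
  le_csSup ⟨B i, fun _ hp => hp.1.2⟩ ⟨⟨h0, h1⟩, H⟩

theorem le_crit_of_forall_lt {v : Fin 2 → ℝ} {k : ℕ} {B : Fin 2 → ℝ} {i : Fin 2} {c : ℝ}
    (hc : c ≤ B i)
    (H : ∀ p, 0 ≤ p → p < c → util v k (lose B i p) i < v i + util v k (pay B i p) i) :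
    c ≤ crit v k B i := by
  by_contra hlt
  rw [not_le] at hlt
  obtain ⟨q, hq1, hq2⟩ := exists_between hlt
  have h0 : 0 ≤ q := (crit_nonneg v k B i).trans hq1.le
  exact absurd (le_crit h0 (hq2.le.trans hc) (H q h0 hq2)) (not_le.2 hq1)

/-- Induction step for properties of plays: the first round is won by the agent with the higher
critical price at the critical price of the other one. -/
theorem cons_of_mem_support {v : Fin 2 → ℝ} {k : ℕ} {B : Fin 2 → ℝ} (hB : Admissible v B)
    {h : List Round} (hh : h ∈ (canonicalOutcome v (k + 1) B).support) :
    ∃ r h', h = r :: h' ∧ r.bids = canonicalBids (crit v k B) ∧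
      r.price = crit v k B (other r.winner) ∧
      crit v k B (other r.winner) ≤ crit v k B r.winner ∧
      0 ≤ r.price ∧ r.price ≤ B r.winner ∧ Admissible v (pay B r.winner r.price) ∧
      h' ∈ (canonicalOutcome v k (pay B r.winner r.price)).support := by
  obtain ⟨r, h', e, hb, h1, h2, h3⟩ := mem_support_succ hh
  have h4 : 0 ≤ r.price := h1 ▸ crit_nonneg _ _ _ _
  have h5 : r.price ≤ B r.winner := h1 ▸ h2.trans (crit_le_budget (hB _).1)
  exact ⟨r, h', e, hb, h1, h2, h4, h5, hB.pay h4 h5, h3⟩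

theorem play_basic {v : Fin 2 → ℝ} (k : ℕ) : ∀ {B : Fin 2 → ℝ}, Admissible v B →
    ∀ h ∈ (canonicalOutcome v k B).support, h.length = k ∧ ∀ i,
      wins h i + wins h (other i) = k ∧ 0 ≤ remaining B h i ∧ remaining B h i ≤ B i := by
  induction k with
  | zero =>
    intro B hB h hh
    simp only [canonicalOutcome, PMF.mem_support_pure_iff] at hh
    subst hh
    exact ⟨rfl, fun i => ⟨rfl, (hB i).1, le_rfl⟩⟩
  | succ k ih =>
    intro B hB h hh
    obtain ⟨r, h', rfl, -, -, -, hp0, -, hA, hh'⟩ := cons_of_mem_support hB hh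
    obtain ⟨hl, H⟩ := ih hA h' hh'
    refine ⟨by simp [hl], fun i => ?_⟩
    obtain ⟨h1, h2, h3⟩ := H i
    rw [remaining_cons]
    rcases eq_or_eq_other r.winner i with hw | hw
    · subst hw
      rw [wins_cons_self, wins_cons_other]
      rw [pay_self] at h3
      exact ⟨by omega, h2, by linarith⟩
    · obtain rfl : other r.winner = i := by rw [hw, other_other]
      rw [wins_cons_other, other_other, wins_cons_self]
      rw [other_other] at h1
      rw [pay_other] at h3
      exact ⟨by omega, h2, h3⟩

/-! ### Payoff bounds and expected utilities -/

theorem payoff_nonneg_le {v : Fin 2 → ℝ} {k : ℕ} {B : Fin 2 → ℝ} (hB : Admissible v B)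
    (i : Fin 2) : ∀ h ∈ (canonicalOutcome v k B).support,
      0 ≤ payoff v B h i ∧ payoff v B h i ≤ v i * k + B i := by
  intro h hh
  obtain ⟨-, H⟩ := play_basic k hB h hh
  obtain ⟨h1, h2, h3⟩ := H i
  have hv : 0 ≤ v i := (hB i).1.trans (hB i).2.le
  have hw : (wins h i : ℝ) ≤ k := by exact_mod_cast (by omega : wins h i ≤ k)
  rw [payoff_eq]
  exact ⟨by positivity, add_le_add (mul_le_mul_of_nonneg_left hw hv) h3⟩

/-- A non-summable real `tsum` is 0 by convention, so a one-sided bound would not suffice; the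
two-sided bound on the support yields summability by comparison. -/
theorem expectation_mem_Icc {α : Type*} (P : PMF α) (f : α → ℝ) {l u : ℝ}
    (hf : ∀ a ∈ P.support, l ≤ f a ∧ f a ≤ u) :
    l ≤ ∑' a, (P a).toReal * f a ∧ ∑' a, (P a).toReal * f a ≤ u := by
  have hs : Summable fun a => (P a).toReal := ENNReal.summable_toReal P.tsum_coe_ne_top
  have h1 : ∑' a, (P a).toReal = 1 := by
    rw [← ENNReal.tsum_toReal_eq P.apply_ne_top, P.tsum_coe, ENNReal.toReal_one]
  have hl : ∀ a, (P a).toReal * l ≤ (P a).toReal * f a := fun a => by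
    by_cases ha : P a = 0
    · simp [ha]
    · exact mul_le_mul_of_nonneg_left (hf a ((P.mem_support_iff a).2 ha)).1 ENNReal.toReal_nonneg
  have hu : ∀ a, (P a).toReal * f a ≤ (P a).toReal * u := fun a => by
    by_cases ha : P a = 0
    · simp [ha]
    · exact mul_le_mul_of_nonneg_left (hf a ((P.mem_support_iff a).2 ha)).2 ENNReal.toReal_nonneg
  have hsf : Summable fun a => (P a).toReal * f a := by
    have h2 : Summable fun a => (P a).toReal * f a - (P a).toReal * l :=
      Summable.of_nonneg_of_le (fun a => sub_nonneg.2 (hl a))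
        (fun a => sub_le_sub_right (hu a) _) ((hs.mul_right u).sub (hs.mul_right l))
    simpa using h2.add (hs.mul_right l)
  constructor
  · have := (hs.mul_right l).tsum_le_tsum hl hsf
    rwa [tsum_mul_right, h1, one_mul] at this
  · have := hsf.tsum_le_tsum hu (hs.mul_right u)
    rwa [tsum_mul_right, h1, one_mul] at this

theorem le_util {v : Fin 2 → ℝ} {k : ℕ} {B : Fin 2 → ℝ} (hB : Admissible v B) {i : Fin 2} {l : ℝ}
    (H : ∀ h ∈ (canonicalOutcome v k B).support, l ≤ payoff v B h i) : l ≤ util v k B i :=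
  (expectation_mem_Icc _ _ fun h hh => ⟨H h hh, (payoff_nonneg_le hB i h hh).2⟩).1

theorem util_le {v : Fin 2 → ℝ} {k : ℕ} {B : Fin 2 → ℝ} (hB : Admissible v B) {i : Fin 2} {u : ℝ}
    (H : ∀ h ∈ (canonicalOutcome v k B).support, payoff v B h i ≤ u) : util v k B i ≤ u :=
  (expectation_mem_Icc _ _ fun h hh => ⟨(payoff_nonneg_le hB i h hh).1, H h hh⟩).2

/-! ### Guaranteed numbers of items -/

/-- With own budget `x` and opposing budget `y`, an agent can afford `a` of `a + b` items at a price
slightly above `y / (b + 1)`, which the opponent cannot pay `b + 1` times. -/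
def Secures (a b : ℕ) (x y : ℝ) : Prop := a = 0 ∨ (a : ℝ) * y < (b + 1) * x

/-- Bounds on all plays of the canonical outcome of `k` items: the number of items that an agent
wins at least, and two-sided bounds on her payoff in terms of her excess
`(b + 1) * x - a * y` over the budget from which on she wins `a` of the `a + b` items. -/
structure PlayBounds (v : Fin 2 → ℝ) (k : ℕ) (c C : ℝ) : Prop where
  wins_ge : ∀ B, Admissible v B → ∀ i, 0 < B i + B (other i) → ∀ a b : ℕ, a + b = k →
    Secures a b (B i) (B (other i)) → ∀ h ∈ (canonicalOutcome v k B).support, a ≤ wins h i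
  -- The extra inequality is the weak form of not securing a + 1 items. Being weak, it admits the
  -- wall itself, where the count may depend on ties: there this bound applies with the lower count
  -- and `payoff_le` with the upper one.
  payoff_ge : ∀ B, Admissible v B → ∀ i, 0 < B i + B (other i) → ∀ a b : ℕ, a + b = k →
    Secures a b (B i) (B (other i)) → (b : ℝ) * B i ≤ (a + 1) * B (other i) →
    ∀ h ∈ (canonicalOutcome v k B).support,
      v i * a + c * ((b + 1) * B i - a * B (other i)) ≤ payoff v B h i
  payoff_le : ∀ B, Admissible v B → ∀ i, 0 < B i + B (other i) → ∀ a b : ℕ, a + b = k →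
    Secures b a (B (other i)) (B i) → (a : ℝ) * B (other i) ≤ (b + 1) * B i →
    ∀ h ∈ (canonicalOutcome v k B).support,
      payoff v B h i ≤ v i * a + C * ((b + 1) * B i - a * B (other i))

section

variable {v : Fin 2 → ℝ} {k : ℕ} {c C : ℝ} {B : Fin 2 → ℝ} {i : Fin 2}

theorem PlayBounds.wins_le (H : PlayBounds v k c C) (hB : Admissible v B)
    (h0 : 0 < B i + B (other i)) {a b : ℕ} (hab : a + b = k)
    (hs : Secures b a (B (other i)) (B i)) :
    ∀ h ∈ (canonicalOutcome v k B).support, wins h i ≤ a := by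
  intro h hh
  have h1 := H.wins_ge B hB (other i) (by rw [other_other]; linarith) b a (by omega)
    (by rwa [other_other]) h hh
  have h2 := ((play_basic k hB h hh).2 i).1
  omega

theorem PlayBounds.mul_le_util (H : PlayBounds v k c C) (hB : Admissible v B)
    (h0 : 0 < B i + B (other i)) (a b : ℕ) (hab : a + b = k)
    (hs : Secures a b (B i) (B (other i))) : v i * a ≤ util v k B i := by
  refine le_util hB fun h hh => ?_
  have h1 : (a : ℝ) ≤ wins h i := by exact_mod_cast H.wins_ge B hB i h0 a b hab hs h hh
  have h2 := ((play_basic k hB h hh).2 i).2.1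
  have hv : 0 ≤ v i := (hB i).1.trans (hB i).2.le
  rw [payoff_eq]
  nlinarith [mul_le_mul_of_nonneg_left h1 hv]

theorem PlayBounds.util_le_mul_add (H : PlayBounds v k c C) (hB : Admissible v B)
    (h0 : 0 < B i + B (other i)) (a b : ℕ) (hab : a + b = k)
    (hs : Secures b a (B (other i)) (B i)) : util v k B i ≤ v i * a + B i := by
  refine util_le hB fun h hh => ?_
  have h1 : (wins h i : ℝ) ≤ a := by exact_mod_cast H.wins_le hB h0 hab hs h hh
  have h2 := ((play_basic k hB h hh).2 i).2.2
  have hv : 0 ≤ v i := (hB i).1.trans (hB i).2.le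
  rw [payoff_eq]
  exact add_le_add (mul_le_mul_of_nonneg_left h1 hv) h2

/-! ### Critical prices if one agent cannot win an item -/

/-- After losing, the poor agent still gets no later item, so she would pay her whole budget for
this one. The rich agent can pay slightly more than that and still secure all k later items. -/
theorem crit_of_poor (H : PlayBounds v k c C) (hB : Admissible v B)
    (h1 : (k + 1) * B i < B (other i)) :
    crit v k B i = B i ∧ B i < crit v k B (other i) := by
  have hx := hB i
  have hy := hB (other i)
  have hk : (0 : ℝ) ≤ k := k.cast_nonneg
  have hkx : 0 ≤ k * B i := mul_nonneg hk hx.1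
  constructor
  · refine (crit_le_budget hx.1).antisymm (le_crit_of_forall_lt le_rfl fun p hp hpx => ?_)
    have hmax : max (B (other i) - p) 0 = B (other i) - p := max_eq_left (by linarith)
    have hL := H.util_le_mul_add (i := i) (hB.lose (i := i) hp)
      (by rw [lose_self, lose_other, hmax]; linarith) 0 k (by omega)
      (by
        rw [lose_self, lose_other, hmax]
        right; push_cast; linarith)
    have hA := hB.pay hp hpx.le
    have hW : 0 ≤ util v k (pay B i p) i := le_util hA fun h hh => (payoff_nonneg_le hA i h hh).1
    rw [lose_self] at hL
    push_cast at hL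
    linarith
  · obtain ⟨q, hq1, hq2⟩ := exists_between (show B i < B (other i) - k * B i by linarith)
    have hq0 : 0 ≤ q := hx.1.trans hq1.le
    have hqy : q ≤ B (other i) := by linarith
    refine hq1.trans_le (le_crit hq0 hqy ?_)
    have hA := hB.pay (i := other i) hq0 hqy
    have hA' := hB.lose (i := other i) hq0
    have hW := H.mul_le_util (i := other i) hA
      (by rw [pay_self, pay_other, other_other]; linarith) k 0 (by omega)
      (by
        rw [pay_self, pay_other, other_other]
        right; push_cast; linarith)
    have hL : util v k (lose B (other i) q) (other i) ≤ v (other i) * k + lose B (other i) q (other i) :=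
      util_le hA' fun h hh => (payoff_nonneg_le hA' (other i) h hh).2
    rw [lose_self] at hL
    linarith

/-! ### Critical prices if the number of items won is determined -/

-- At any price leaving excess d < δ e after a win, where e is the present excess, losing is at
-- least as good: it leaves an excess of at least e / 2, and C δ ≤ c / 2 makes this outweigh d.
set_option maxHeartbeats 400000 in
theorem crit_add_le_of_interior (H : PlayBounds v k c C) (hB : Admissible v B) {x y : ℝ} (hx : B i = x)
    (hy : B (other i) = y) {a b : ℕ}
    (hab : a + b + 1 = k) (h1 : (a + 1) * y < (b + 2) * x)
    (h2 : (b + 1) * x < (a + 2) * y) {δ : ℝ} (hc : 0 < c) (hδ : 0 < δ)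
    (hδ1 : δ * (k + 1) ≤ 1 / 2) (hδ2 : C * δ ≤ c / 2) (hC : 0 < C) :
    (b + 2) * crit v k B i ≤
      (b + 2) * x - a * y - δ * ((b + 2) * x - (a + 1) * y) := by
  have hv := (hB i).2
  have hx0 : 0 ≤ x := hx ▸ (hB i).1
  have hy0 : 0 ≤ y := hy ▸ (hB (other i)).1
  rw [hx] at hv
  have ha : (0 : ℝ) ≤ a := a.cast_nonneg
  have hb : (0 : ℝ) ≤ b := b.cast_nonneg
  have hkab : (k : ℝ) = a + b + 1 := by rw [← hab]; push_cast; ring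
  have hxpos : 0 < x := by
    by_contra hn
    obtain rfl : x = 0 := le_antisymm (not_lt.1 hn) hx0
    nlinarith
  have hypos : 0 < y := by
    by_contra hn
    obtain rfl : y = 0 := le_antisymm (not_lt.1 hn) hy0
    nlinarith
  obtain ⟨e, he⟩ : ∃ e, e = (b + 2) * x - (a + 1) * y := ⟨_, rfl⟩
  have he0 : 0 < e := by linarith
  rw [← he]
  have hδ3 : δ ≤ 1 / 2 := by nlinarith
  have hδe : δ * e ≤ e / 2 := by nlinarith
  suffices hs : crit v k B i ≤ ((b + 2) * x - a * y - δ * e) / (b + 2) by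
    rw [le_div_iff₀ (by positivity)] at hs
    linarith
  refine crit_le (div_nonneg (by nlinarith) (by positivity)) fun p hp0 hpx hp => ?_
  rw [div_lt_iff₀ (by positivity)] at hp
  rw [hx] at hpx
  -- d and g are the excesses after winning and after losing at price p. A weighted sum of them is a
  -- fixed multiple of e, so a small d forces a large g.
  obtain ⟨d, hd⟩ : ∃ d, d = (b + 2) * (x - p) - a * y := ⟨_, rfl⟩
  obtain ⟨g, hg⟩ : ∃ g, g = (b + 1) * x - (a + 1) * (y - p) := ⟨_, rfl⟩
  have hde : d < δ * e := by linarith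
  have hdg : (b + 2) * g + (a + 1) * d = (a + b + 2) * e := by rw [hg, hd, he]; ring
  have hae : 0 ≤ a * e := by positivity
  have hbe : 0 ≤ b * e := by positivity
  have hge : e / 2 ≤ g := by
    have h3 : (a + 1) * d ≤ (a + 1) * (e / 2) := by gcongr; linarith
    exact le_of_mul_le_mul_left (show (b + 2) * (e / 2) ≤ (b + 2) * g by linarith) (by positivity)
  have hAW := hB.pay (i := i) hp0 (by rwa [hx])
  have hAL := hB.lose (i := i) hp0
  have hL0 : 0 < lose B i p i + lose B i p (other i) := by
    rw [lose_self, lose_other, hx]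
    linarith [le_max_right (B (other i) - p) 0]
  have hW0 : 0 < pay B i p i + pay B i p (other i) := by
    rw [pay_self, pay_other, hx, hy]; linarith
  have hm : (a + 1) * max (y - p) 0 < (b + 1) * x := by
    rcases max_cases (y - p) 0 with ⟨h, -⟩ | ⟨h, -⟩ <;> rw [h]
    · linarith
    · nlinarith
  have hsL : Secures (a + 1) b (lose B i p i) (lose B i p (other i)) := by
    rw [lose_self, lose_other, hx, hy]
    right; push_cast; exact hm
  -- For d < 0 winning costs a later item, and item counts alone decide. For a = 0 this would
  -- require p > x.
  rcases lt_or_ge d 0 with hd0 | hd0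
  · obtain ⟨a, rfl⟩ : ∃ a', a = a' + 1 := by
      refine Nat.exists_eq_succ_of_ne_zero ?_
      rintro rfl
      rw [hd] at hd0
      push_cast at hd0
      nlinarith
    have hW := H.util_le_mul_add (i := i) hAW hW0 a (b + 2) (by omega) (by
      rw [pay_self, pay_other, hx, hy]
      right
      push_cast at hd ⊢
      linarith)
    have hL := H.mul_le_util (i := i) hAL hL0 (a + 1 + 1) b (by omega) hsL
    rw [pay_self, hx] at hW
    push_cast at hL
    linarith
  · have hsW : Secures (b + 1) a (pay B i p (other i)) (pay B i p i) := by
      rw [pay_self, pay_other, hx, hy]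
      right
      push_cast
      have h3 : (b + 1) * e < (a + b + 3) * y := by
        have := mul_lt_mul_of_pos_left h2 (show 0 < (b : ℝ) + 2 by positivity)
        rw [he]; linarith
      have h4 : (b + 1) * d < (a + b + 2) * y := by
        have := mul_lt_mul_of_pos_left (show d < e / 2 by linarith) (show 0 < (b : ℝ) + 1 by positivity)
        have : 0 ≤ (a + b + 1) * y := by positivity
        linarith
      have h5 : (b + 2) * ((b + 1) * (x - p)) < (b + 2) * ((a + 1) * y) := by
        have : (b + 2) * ((b + 1) * (x - p)) = (b + 1) * d + (b + 1) * a * y := by rw [hd]; ring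
        linarith
      exact lt_of_mul_lt_mul_left h5 (by positivity)
    -- Either both continuations give a + 1 items in total and money decides, or the opponent's
    -- payment lets agent i secure a + 2 items by losing.
    rcases le_or_gt (b * x) ((a + 2) * max (y - p) 0) with hm2 | hm2
    · have hW : util v k (pay B i p) i ≤ v i * a + C * d :=
        util_le hAW fun h hh => by
          have := H.payoff_le _ hAW i hW0 a (b + 1) (by omega) hsW (by
            rw [pay_self, pay_other, hx, hy]; push_cast; linarith) h hh
          rw [pay_self, pay_other, hx, hy] at this
          push_cast at this
          rw [hd]
          linarith
      have hL : v i * (a + 1) + c * (e / 2) ≤ util v k (lose B i p) i :=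
        le_util hAL fun h hh => by
          have := H.payoff_ge _ hAL i hL0 (a + 1) b (by omega) hsL (by
            rw [lose_self, lose_other, hx, hy]; push_cast; linarith) h hh
          rw [lose_self, lose_other, hx, hy] at this
          push_cast at this
          refine le_trans (add_le_add le_rfl (mul_le_mul_of_nonneg_left ?_ hc.le)) this
          rcases max_cases (y - p) 0 with ⟨h, -⟩ | ⟨h, -⟩ <;> rw [h]
          · linarith
          · rw [h] at hm2
            have : 0 ≤ (b : ℝ) * x := by positivity
            have : 0 < (a + 1) * y := by positivity
            linarith
      have h5 : C * d ≤ C * (δ * e) := mul_le_mul_of_nonneg_left hde.le hC.le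
      have h6 : C * δ * e ≤ c / 2 * e := mul_le_mul_of_nonneg_right hδ2 he0.le
      linarith
    · obtain ⟨b, rfl⟩ : ∃ b', b = b' + 1 := by
        refine Nat.exists_eq_succ_of_ne_zero ?_
        rintro rfl
        have := le_max_right (y - p) 0
        push_cast at hm2
        nlinarith
      have hW := H.util_le_mul_add (i := i) hAW hW0 a (b + 1 + 1) (by omega) hsW
      have hL := H.mul_le_util (i := i) hAL hL0 (a + 2) b (by omega) (by
        rw [lose_self, lose_other, hx, hy]
        right; push_cast at hm2 ⊢; exact hm2)
      rw [pay_self, hx] at hW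
      push_cast at hL
      linarith

/-- Below this price agent i wins now and still secures a + 1 later items, while losing limits her
to a + 1 in total. -/
theorem le_crit_of_interior (H : PlayBounds v k c C) (hB : Admissible v B) {x y : ℝ} (hx : B i = x)
    (hy : B (other i) = y) {a b : ℕ}
    (hab : a + b + 1 = k) (h1 : (a + 1) * y < (b + 2) * x)
    (h2 : (b + 1) * x < (a + 2) * y) :
    (b + 1) * x - (a + 1) * y ≤ (b + 1) * crit v k B i := by
  have hv := (hB i).2
  have hx0 : 0 ≤ x := hx ▸ (hB i).1
  have hy0 : 0 ≤ y := hy ▸ (hB (other i)).1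
  rw [hx] at hv
  have ha : (0 : ℝ) ≤ a := a.cast_nonneg
  have hb : (0 : ℝ) ≤ b := b.cast_nonneg
  have hypos : 0 < y := by
    by_contra hn
    obtain rfl : y = 0 := le_antisymm (not_lt.1 hn) hy0
    nlinarith
  suffices hs : ((b + 1) * x - (a + 1) * y) / (b + 1) ≤ crit v k B i by
    rw [div_le_iff₀ (by positivity)] at hs
    linarith
  refine le_crit_of_forall_lt ?_ fun p hp0 hp => ?_
  · rw [div_le_iff₀ (by positivity), hx]
    nlinarith
  rw [lt_div_iff₀ (by positivity)] at hp
  have h3 : (a + 1) * y < (b + 1) * (x - p) := by linarith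
  have hpx : p ≤ x := by
    by_contra hn
    nlinarith
  have hAW := hB.pay (i := i) hp0 (by rwa [hx])
  have hAL := hB.lose (i := i) hp0
  have h4 : b * x < (a + 2) * (y - p) := by
    have h5 : (a + b + 2) * y - (b + 1) * x < (b + 1) * (y - p) := by linarith
    have h6 : (b + 1) * (b * x) < (b + 1) * ((a + 2) * (y - p)) := by
      have := mul_lt_mul_of_pos_left h5 (show 0 < (a : ℝ) + 2 by positivity)
      have := mul_lt_mul_of_pos_left h2 (show 0 < (a : ℝ) + b + 2 by positivity)
      linarith
    exact lt_of_mul_lt_mul_left h6 (by positivity)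
  have hyp : 0 < y - p := by
    have : 0 ≤ b * x := by positivity
    by_contra hn
    nlinarith
  have hW := H.mul_le_util (i := i) hAW (by
      rw [pay_self, pay_other, hx, hy]; linarith) (a + 1) b (by omega) (by
      rw [pay_self, pay_other, hx, hy]
      right; push_cast; exact h3)
  have hL := H.util_le_mul_add (i := i) hAL (by
      rw [lose_self, lose_other, hx, hy, max_eq_left hyp.le]; linarith) (a + 1) b (by omega) (by
      rw [lose_self, lose_other, hx, hy, max_eq_left hyp.le]
      right; push_cast; linarith)
  rw [lose_self, hx] at hL
  push_cast at hL hW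
  linarith

-- Mirror image of the upper estimate: at the price where losing leaves excess only δ e, winning
-- leaves at least e and is strictly better.
set_option maxHeartbeats 400000 in
theorem add_le_crit_of_interior (H : PlayBounds v k c C) (hB : Admissible v B) {x y : ℝ} (hx : B i = x)
    (hy : B (other i) = y) {a b : ℕ}
    (hab : a + b + 1 = k) (h1 : (a + 1) * y < (b + 2) * x)
    (h2 : (b + 1) * x < (a + 2) * y) {δ : ℝ} (hc : 0 < c) (hδ : 0 < δ)
    (hδ1 : δ * (k + 1) ≤ 1 / 2) (hδ2 : C * δ ≤ c / 2) :
    (a + 1) * y - (b + 1) * x + δ * ((b + 2) * x - (a + 1) * y) ≤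
      (a + 1) * crit v k B i := by
  have hv := (hB i).2
  have hx0 : 0 ≤ x := hx ▸ (hB i).1
  have hy0 : 0 ≤ y := hy ▸ (hB (other i)).1
  rw [hx] at hv
  have ha : (0 : ℝ) ≤ a := a.cast_nonneg
  have hb : (0 : ℝ) ≤ b := b.cast_nonneg
  have hkab : (k : ℝ) = a + b + 1 := by rw [← hab]; push_cast; ring
  have hypos : 0 < y := by
    by_contra hn
    obtain rfl : y = 0 := le_antisymm (not_lt.1 hn) hy0
    nlinarith
  have hxpos : 0 < x := by
    by_contra hn
    obtain rfl : x = 0 := le_antisymm (not_lt.1 hn) hx0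
    nlinarith
  obtain ⟨e, he⟩ : ∃ e, e = (b + 2) * x - (a + 1) * y := ⟨_, rfl⟩
  have he0 : 0 < e := by linarith
  rw [← he]
  have hδ3 : δ ≤ 1 / 2 := by nlinarith
  have hδe : δ * e ≤ e / 2 := by nlinarith
  -- q solves (b + 1) x - (a + 1) (y - q) = δ e.
  obtain ⟨q, hq⟩ : ∃ q, q = ((a + 1) * y - (b + 1) * x + δ * e) / (a + 1) := ⟨_, rfl⟩
  have hqa : (a + 1) * q = (a + 1) * y - (b + 1) * x + δ * e := by rw [hq]; field_simp
  rw [← hqa]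
  refine mul_le_mul_of_nonneg_left ?_ (by positivity)
  rcases lt_or_ge q 0 with hq0 | hq0
  · exact hq0.le.trans (crit_nonneg _ _ _ _)
  obtain ⟨d, hd⟩ : ∃ d, d = (b + 2) * (x - q) - a * y := ⟨_, rfl⟩
  have hdg : (a + 1) * d = (a + b + 2) * e - (b + 2) * (δ * e) := by
    have : (a + 1) * d = (b + 2) * ((a + 1) * x - (a + 1) * q) - (a + 1) * (a * y) := by
      rw [hd]; ring
    rw [this, hqa, he]; ring
  have hde : e ≤ d := by
    have h3 : (b + 2) * (δ * e) ≤ (b + 2) * (e / 2) := by gcongr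
    have h4 : 0 ≤ b * e := by positivity
    exact le_of_mul_le_mul_left (show (a + 1) * e ≤ (a + 1) * d by linarith) (by positivity)
  have hqx : 0 < x - q := by
    have : 0 ≤ a * y := by positivity
    by_contra hn
    nlinarith
  have hAW := hB.pay (i := i) hq0 (by rw [hx]; linarith)
  have hAL := hB.lose (i := i) hq0
  have hyq : 0 < y - q := by
    have h3 : 0 < (a + 1) * (y - q) := by
      have : 0 < (a + 1) * y := by positivity
      have : 0 ≤ b * x := by positivity
      linarith
    exact pos_of_mul_pos_right h3 (by positivity)
  have h3 : b * x < (a + 2) * (y - q) := by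
    have h4 : (a + 2) * (δ * e) < (a + b + 2) * x := by
      have h5 : e ≤ (b + 2) * x := by
        have : 0 ≤ (a + 1) * y := by positivity
        linarith
      have h6 : δ * e ≤ δ * ((b + 2) * x) := mul_le_mul_of_nonneg_left h5 hδ.le
      have h7 : δ * (a + b + 2) ≤ 1 / 2 := by rw [hkab] at hδ1; linarith
      have h8 : (a + 2) * (δ * (b + 2)) ≤ (a + b + 2) * (δ * (a + b + 2)) := by
        gcongr <;> linarith
      have h9 : (a + b + 2) * (δ * (a + b + 2)) ≤ (a + b + 2) * (1 / 2) := by gcongr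
      calc (a + 2) * (δ * e) ≤ (a + 2) * (δ * ((b + 2) * x)) := by gcongr
        _ = ((a + 2) * (δ * (b + 2))) * x := by ring
        _ ≤ (a + b + 2) * (1 / 2) * x := mul_le_mul_of_nonneg_right (h8.trans h9) hx0
        _ < (a + b + 2) * x := by linarith [mul_pos (show 0 < (a : ℝ) + b + 2 by positivity) hxpos]
    have h5 : (a + 1) * (b * x) < (a + 1) * ((a + 2) * (y - q)) := by
      have : (a + 1) * ((a + 2) * (y - q)) = (a + 2) * ((a + 1) * y - (a + 1) * q) := by ring
      rw [this, hqa]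
      linarith
    exact lt_of_mul_lt_mul_left h5 (by positivity)
  have hW0 : 0 < pay B i q i + pay B i q (other i) := by
    rw [pay_self, pay_other, hx, hy]; linarith
  have hL0 : 0 < lose B i q i + lose B i q (other i) := by
    rw [lose_self, lose_other, hx, hy, max_eq_left hyq.le]; linarith
  have hsL : Secures b (a + 1) (lose B i q (other i)) (lose B i q i) := by
    rw [lose_self, lose_other, hx, hy, max_eq_left hyq.le]
    right; push_cast; linarith
  refine le_crit hq0 (by rw [hx]; linarith) ?_
  rcases le_or_gt ((b + 1) * (x - q)) ((a + 1) * y) with hm | hm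
  · have hW : v i * a + c * d ≤ util v k (pay B i q) i :=
      le_util hAW fun h hh => by
        have := H.payoff_ge _ hAW i hW0 a (b + 1) (by omega) (by
          rw [pay_self, pay_other, hx, hy]
          right; push_cast; linarith) (by
          rw [pay_self, pay_other, hx, hy]; push_cast; exact hm) h hh
        rw [pay_self, pay_other, hx, hy] at this
        push_cast at this
        rw [hd]
        linarith
    have hL : util v k (lose B i q) i ≤ v i * (a + 1) + C * (δ * e) :=
      util_le hAL fun h hh => by
        have := H.payoff_le _ hAL i hL0 (a + 1) b (by omega) hsL (by
          rw [lose_self, lose_other, hx, hy, max_eq_left hyq.le]; push_cast; linarith [mul_pos hδ he0]) h hh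
        rw [lose_self, lose_other, hx, hy, max_eq_left hyq.le] at this
        push_cast at this
        refine this.trans_eq ?_
        rw [show (b + 1) * x - (a + 1) * (y - q) = δ * e by linarith]
    have h5 : C * δ * e ≤ c / 2 * e := mul_le_mul_of_nonneg_right hδ2 he0.le
    have h6 : c * e ≤ c * d := mul_le_mul_of_nonneg_left hde hc.le
    have h7 : 0 < c * e := by positivity
    linarith
  · have hW := H.mul_le_util (i := i) hAW hW0 (a + 1) b (by omega) (by
      rw [pay_self, pay_other, hx, hy]
      right; push_cast; exact hm)
    have hL := H.util_le_mul_add (i := i) hAL hL0 (a + 1) b (by omega) hsL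
    rw [lose_self, hx] at hL
    push_cast at hL hW
    linarith

/-! ### Critical prices if the ratio of the budgets is critical -/

/-- Below s, winning totals at least a + 1 items and losing at most a. Above s, winning totals at
most a, while losing yields at least a + 1, or, if b = 0, a items with the whole budget kept. -/
theorem crit_of_ratio (H : PlayBounds v k c C)
    (hz : ∀ B, Admissible v B → ∀ i, 0 < B i → B (other i) = 0 →
      ∀ h ∈ (canonicalOutcome v k B).support, v i * k + B i ≤ payoff v B h i)
    (hB : Admissible v B) {a b : ℕ} (hab : a + b = k) {s : ℝ} (hs : 0 < s)
    (h1 : B i = (a + 1) * s) (h2 : B (other i) = (b + 1) * s) : crit v k B i = s := by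
  have hv := (hB i).2
  have ha : (0 : ℝ) ≤ a := a.cast_nonneg
  have hb : (0 : ℝ) ≤ b := b.cast_nonneg
  have has : 0 ≤ a * s := by positivity
  have hbs : 0 ≤ b * s := by positivity
  refine critPrice_eq _ _ _ _ ⟨⟨hs.le, by rw [h1]; linarith⟩, fun p hp => ⟨fun hps => ?_, fun hps => ?_⟩⟩
  · change util v k (lose B i p) i < v i + util v k (pay B i p) i
    have hAW := hB.pay (i := i) hp.1 hp.2
    have hAL := hB.lose (i := i) hp.1
    have hyq : 0 < B (other i) - p := by rw [h2]; linarith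
    have hW := H.mul_le_util (i := i) hAW (by
      rw [pay_self, pay_other, h1, h2]; linarith) a b hab (by
      rw [pay_self, pay_other, h1, h2]
      right; nlinarith)
    have hL := H.util_le_mul_add (i := i) hAL (by
      rw [lose_self, lose_other, max_eq_left hyq.le]; linarith [(hB i).1]) a b hab (by
      rw [lose_self, lose_other, max_eq_left hyq.le, h1, h2]
      right; nlinarith)
    rw [lose_self] at hL
    linarith
  · change v i + util v k (pay B i p) i < util v k (lose B i p) i
    have hAW := hB.pay (i := i) hp.1 hp.2
    have hAL := hB.lose (i := i) hp.1
    obtain ⟨a, rfl⟩ : ∃ a', a = a' + 1 := by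
      refine Nat.exists_eq_succ_of_ne_zero ?_
      rintro rfl
      have := hp.2
      rw [h1] at this
      push_cast at this
      linarith
    have hW := H.util_le_mul_add (i := i) hAW (by
      rw [pay_self, pay_other, h2]; linarith [hp.2]) a (b + 1) (by omega) (by
      rw [pay_self, pay_other, h1, h2]
      right; push_cast; nlinarith)
    rw [pay_self] at hW
    have hx : 0 < B i := by rw [h1]; positivity
    have hp0 : 0 < p := hs.trans hps
    have hL0 : 0 < lose B i p i + lose B i p (other i) := by
      rw [lose_self, lose_other]
      linarith [le_max_right (B (other i) - p) 0]
    -- For b = 0 a price above s exhausts the opponent. The item counts can then tie, and the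
    -- positive payment p makes the difference.
    cases b with
    | zero =>
      have hL : v i * k + B i ≤ util v k (lose B i p) i := le_util hAL fun h hh => by
        have := hz _ hAL i (by rwa [lose_self]) (by
          rw [lose_other, h2]
          refine max_eq_right ?_
          push_cast; linarith) h hh
        rwa [lose_self] at this
      rw [show (k : ℝ) = a + 1 by rw [← hab]; push_cast; ring] at hL
      linarith
    | succ b =>
      have hL := H.mul_le_util (i := i) hAL hL0 (a + 1 + 1) b (by omega) (by
        rw [lose_self, lose_other, h1, h2]
        right
        push_cast
        rcases max_cases ((b + 1 + 1 : ℝ) * s - p) 0 with ⟨h, -⟩ | ⟨h, -⟩ <;> rw [h]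
        · nlinarith
        · rw [mul_zero]; positivity)
      push_cast at hL
      linarith [hp.2]

end

/-! ### Plays in which one agent has exhausted her budget -/

/-- If agent `i` has exhausted her budget, the other one wins all items at price `0`. -/
def SweepsExhausted (v : Fin 2 → ℝ) (k : ℕ) : Prop :=
  ∀ B, Admissible v B → ∀ i, B i = 0 → 0 < B (other i) →
    ∀ h ∈ (canonicalOutcome v k B).support, ∀ r ∈ h, r.winner = other i ∧ r.price = 0

theorem pay_zero (B : Fin 2 → ℝ) (i : Fin 2) : pay B i 0 = B := by
  simp [pay]

theorem payoff_of_sweep (v B : Fin 2 → ℝ) (i : Fin 2) (h : List Round)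
    (H : ∀ r ∈ h, r.winner = i ∧ r.price = 0) : payoff v B h i = v i * h.length + B i := by
  induction h with
  | nil => simp [payoff, remaining]
  | cons r h ih =>
    obtain ⟨hw, hp⟩ := H r (by simp)
    have h1 := payoff_cons_self v B r h
    rw [hp, pay_zero, hw, ih fun r hr => H r (by simp [hr])] at h1
    rw [h1, List.length_cons]
    push_cast
    ring

section

variable {v : Fin 2 → ℝ} {k : ℕ} {c C δ : ℝ} {B : Fin 2 → ℝ} {i : Fin 2}

/-- The two possible first rounds of a play, from the point of view of agent `i`. -/
theorem win_or_lose (hB : Admissible v B) (i : Fin 2) {h : List Round}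
    (hh : h ∈ (canonicalOutcome v (k + 1) B).support) :
    ∃ r h', h = r :: h' ∧ r.bids = canonicalBids (crit v k B) ∧
      ((r.winner = i ∧ r.price = crit v k B (other i) ∧ crit v k B (other i) ≤ crit v k B i ∧
          r.price ≤ B i ∧ Admissible v (pay B i r.price) ∧
          h' ∈ (canonicalOutcome v k (pay B i r.price)).support ∧ wins h i = wins h' i + 1 ∧
          payoff v B h i = v i + payoff v (pay B i r.price) h' i) ∨
        (r.winner = other i ∧ r.price = crit v k B i ∧ crit v k B i ≤ crit v k B (other i) ∧
          r.price ≤ B (other i) ∧ Admissible v (pay B (other i) r.price) ∧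
          h' ∈ (canonicalOutcome v k (pay B (other i) r.price)).support ∧ wins h i = wins h' i ∧
          payoff v B h i = payoff v (pay B (other i) r.price) h' i)) := by
  obtain ⟨r, h', rfl, hb, h1, h2, h3, h4, h5, h6⟩ := cons_of_mem_support hB hh
  refine ⟨r, h', rfl, hb, ?_⟩
  rcases eq_or_eq_other r.winner i with hw | hw
  · subst hw
    exact .inl ⟨rfl, h1, h2, h4, h5, h6, wins_cons_self r h', payoff_cons_self v B r h'⟩
  · obtain rfl : other r.winner = i := by rw [hw, other_other]
    rw [other_other]
    exact .inr ⟨rfl, h1, h2, h4, h5, h6, wins_cons_other r h', payoff_cons_other v B r h'⟩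

/-- The exhausted agent has critical price 0 and the other a strictly positive one, so no tie can
occur. -/
theorem PlayBounds.sweeps_succ (H : PlayBounds v k c C) (hz : SweepsExhausted v k) :
    SweepsExhausted v (k + 1) := by
  intro B hB i hi ho h hh
  obtain ⟨hc1, hc2⟩ := crit_of_poor (i := i) H hB (by rw [hi]; simpa using ho)
  obtain ⟨r, h', rfl, -, ⟨-, -, h1, -⟩ | ⟨hw, hp, -, -, hA, hh', -⟩⟩ := win_or_lose hB i hh
  · linarith
  · have hp0 : r.price = 0 := by rw [hp, hc1, hi]
    rw [hp0, pay_zero] at hh'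
    intro r' hr'
    rcases List.mem_cons.1 hr' with rfl | hr'
    · exact ⟨hw, hp0⟩
    · exact hz B hB i hi ho h' hh' r' hr'

/-! ### Induction on the number of items -/

/-- The price is the loser's critical price and at most the winner's, so the estimates for both
agents apply to it. Both excesses after the payment are then positive and comparable to those
before. -/
theorem win_bounds (H : PlayBounds v k c C) (hB : Admissible v B) {x y : ℝ} (hx : B i = x)
    (hy : B (other i) = y) {a b : ℕ} (hab : a + b + 1 = k) (h1 : (a + 1) * y < (b + 2) * x)
    (h2 : (b + 1) * x < (a + 2) * y) (hc : 0 < c) (hδ : 0 < δ) (hδ1 : δ * (k + 1) ≤ 1 / 2)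
    (hδ2 : C * δ ≤ c / 2) (hC : 0 < C) {p : ℝ} (hp : p = crit v k B (other i))
    (hle : crit v k B (other i) ≤ crit v k B i) :
    (δ * ((b + 2) * x - (a + 1) * y) ≤ (b + 2) * (x - p) - a * y ∧
      (b + 2) * (x - p) - a * y ≤ (k + 1) * ((b + 2) * x - (a + 1) * y)) ∧
    (δ * ((a + 2) * y - (b + 1) * x) ≤ (a + 1) * y - (b + 1) * (x - p) ∧
      (a + 1) * y - (b + 1) * (x - p) ≤ (k + 1) * ((a + 2) * y - (b + 1) * x)) := by
  have ha : (0 : ℝ) ≤ a := a.cast_nonneg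
  have hb : (0 : ℝ) ≤ b := b.cast_nonneg
  have hkab : (k : ℝ) = a + b + 1 := by rw [← hab]; push_cast; ring
  have hxo : B (other (other i)) = x := by rw [other_other, hx]
  have hba : b + a + 1 = k := by omega
  have hA := crit_add_le_of_interior H hB hx hy hab h1 h2 hc hδ hδ1 hδ2 hC
  have hA' := crit_add_le_of_interior H hB hy hxo hba h2 h1 hc hδ hδ1 hδ2 hC
  have hB' := add_le_crit_of_interior H hB hy hxo hba h2 h1 hc hδ hδ1 hδ2
  have hC' := le_crit_of_interior H hB hy hxo hba h2 h1
  rw [← hp] at hA' hB' hC' hle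
  have hpA : (b + 2) * p ≤ (b + 2) * crit v k B i := by gcongr
  have hd : 0 < δ * ((b + 2) * x - (a + 1) * y) := mul_pos hδ (by linarith)
  have hg : 0 < δ * ((a + 2) * y - (b + 1) * x) := mul_pos hδ (by linarith)
  rw [hkab]
  refine ⟨⟨by linarith, ?_⟩, by linarith, ?_⟩
  · have h3 : 0 ≤ a * ((b + 2) * (x - p) - a * y) := mul_nonneg ha (by linarith)
    have h4 : (b + 2) * ((a + 1) * y - (b + 1) * x) ≤ (b + 2) * ((a + 1) * p) := by gcongr
    linarith
  · have h3 : 0 ≤ (a + 1) * ((a + 1) * y - (b + 1) * (x - p)) :=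
      mul_nonneg (by positivity) (by linarith)
    have h4 : (b + 1) * ((a + 2) * p) ≤ (b + 1) * ((a + 2) * y - b * x) := by gcongr; linarith
    linarith

theorem bounds_of_interior (H : PlayBounds v k c C) (hB : Admissible v B)
    (h0 : 0 < B i + B (other i)) {a b : ℕ} (hab : a + b = k + 1)
    (hs : Secures a b (B i) (B (other i))) (hs' : Secures b a (B (other i)) (B i))
    (hc : 0 < c) (hδ : 0 < δ) (hδ1 : δ * (k + 2) ≤ 1 / 2) (hδ2 : C * δ ≤ c / 2) (hC : 0 < C) :
    ∀ h ∈ (canonicalOutcome v (k + 1) B).support, a ≤ wins h i ∧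
      v i * a + δ * c * ((b + 1) * B i - a * B (other i)) ≤ payoff v B h i ∧
      payoff v B h i ≤ v i * a + (k + 1) * C * ((b + 1) * B i - a * B (other i)) := by
  have hk : (0 : ℝ) ≤ k := k.cast_nonneg
  have hδ3 : δ ≤ 1 := by nlinarith
  have hδ4 : δ * (k + 1) ≤ 1 / 2 := by linarith
  intro h hh
  obtain ⟨x, hx⟩ : ∃ x, B i = x := ⟨_, rfl⟩
  obtain ⟨y, hy⟩ : ∃ y, B (other i) = y := ⟨_, rfl⟩
  have hx0 : 0 ≤ x := hx ▸ (hB i).1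
  have hy0 : 0 ≤ y := hy ▸ (hB (other i)).1
  rw [hx, hy] at hs h0 ⊢
  rw [hx, hy] at hs'
  obtain ⟨r, h', rfl, -, hcase⟩ := win_or_lose hB i hh
  -- For a = 0 or b = 0 one agent is too poor to win any item, and the critical prices come from
  -- `crit_of_poor`.
  rcases Nat.eq_zero_or_pos a with rfl | hapos
  · obtain rfl : b = k + 1 := by omega
    have h1 : (k + 1) * x < y := by simpa [Secures] using hs'
    obtain ⟨hc1, hc2⟩ := crit_of_poor (i := i) H hB (by rwa [hx, hy])
    rcases hcase with ⟨-, -, hle, -⟩ | ⟨-, hp, -, hpy, hA, hh', hw, hpay⟩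
    · linarith
    · rw [hc1, hx] at hp
      rw [hp] at hA hh' hpay
      have hkx : 0 ≤ k * x := by positivity
      have hge := H.payoff_ge _ hA i (by rw [pay_other_self, pay_self, hx, hy]; linarith)
        0 k (by omega) (.inl rfl) (by
          rw [pay_other_self, pay_self, hx, hy]; push_cast; linarith) h' hh'
      have hle := H.payoff_le _ hA i (by rw [pay_other_self, pay_self, hx, hy]; linarith)
        0 k (by omega) (by
          rw [pay_other_self, pay_self, hx, hy]
          right; push_cast; linarith) (by
          rw [pay_other_self, pay_self, hx, hy]; push_cast; linarith) h' hh'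
      rw [pay_other_self, pay_self, hx, hy] at hge hle
      refine ⟨Nat.zero_le _, ?_, ?_⟩
      · rw [hpay]
        refine le_trans ?_ hge
        have h2 : (δ * (k + 2)) * (c * x) ≤ 1 * (c * x) :=
          mul_le_mul_of_nonneg_right (by linarith) (by positivity)
        have h3 : 0 ≤ c * (k * x) := by positivity
        push_cast
        linarith
      · rw [hpay]
        refine hle.trans ?_
        have h3 : 0 ≤ C * (k * x) := by positivity
        have h4 : 0 ≤ C * x := by positivity
        have h5 : 0 ≤ C * (k * (k * x)) := by positivity
        push_cast
        linarith
  rcases Nat.eq_zero_or_pos b with rfl | hbpos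
  · obtain rfl : a = k + 1 := by omega
    have h1 : (k + 1) * y < x := by simpa [Secures] using hs
    obtain ⟨hc1, hc2⟩ := crit_of_poor (i := other i) H hB (by rwa [other_other, hx, hy])
    rw [other_other] at hc2
    rcases hcase with ⟨-, hp, -, hpx, hA, hh', hw, hpay⟩ | ⟨-, -, hle, -⟩
    · rw [hc1, hy] at hp
      rw [hp] at hA hh' hpay
      have hky : 0 ≤ k * y := by positivity
      have hsW : Secures k 0 (pay B i y i) (pay B i y (other i)) := by
        rw [pay_other, pay_self, hx, hy]
        right; push_cast; linarith
      have hpos : 0 < pay B i y i + pay B i y (other i) := by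
        rw [pay_other, pay_self, hx, hy]; linarith
      have hwi := H.wins_ge _ hA i hpos k 0 (by omega) hsW h' hh'
      have hge := H.payoff_ge _ hA i hpos k 0 (by omega) hsW (by
          rw [pay_other, pay_self, hx, hy]; push_cast; linarith) h' hh'
      have hle := H.payoff_le _ hA i hpos k 0 (by omega) (.inl rfl) (by
          rw [pay_other, pay_self, hx, hy]; push_cast; linarith) h' hh'
      rw [pay_other, pay_self, hx, hy] at hge hle
      have he : 0 ≤ x - (k + 1) * y := by linarith
      push_cast at hge hle ⊢
      refine ⟨by omega, ?_, ?_⟩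
      · have h2 : δ * (c * (x - (k + 1) * y)) ≤ 1 * (c * (x - (k + 1) * y)) :=
          mul_le_mul_of_nonneg_right hδ3 (by positivity)
        linarith
      · have h2 : 0 ≤ k * (C * (x - (k + 1) * y)) := by positivity
        linarith
    · linarith
  obtain ⟨a, rfl⟩ := Nat.exists_eq_succ_of_ne_zero hapos.ne'
  obtain ⟨b, rfl⟩ := Nat.exists_eq_succ_of_ne_zero hbpos.ne'
  have hk' : a + b + 1 = k := by omega
  have h1 : (a + 1) * y < (b + 2) * x := by
    have := hs.resolve_left (Nat.succ_ne_zero a)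
    push_cast at this
    linarith
  have h2 : (b + 1) * x < (a + 2) * y := by
    have := hs'.resolve_left (Nat.succ_ne_zero b)
    push_cast at this
    linarith
  have he : 0 < δ * ((b + 2) * x - (a + 1) * y) := mul_pos hδ (by linarith)
  have he' : 0 < δ * ((a + 2) * y - (b + 1) * x) := mul_pos hδ (by linarith)
  have ha : (0 : ℝ) ≤ a := a.cast_nonneg
  have hb : (0 : ℝ) ≤ b := b.cast_nonneg
  have hypos : 0 < y := by
    by_contra hn
    have : 0 ≤ (b + 1) * x := by positivity
    nlinarith
  have hxpos : 0 < x := by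
    by_contra hn
    have : 0 ≤ (a + 1) * y := by positivity
    nlinarith
  rcases hcase with ⟨-, hp, hle, hpx, hA, hh', hw, hpay⟩ | ⟨-, hp, hle, hpy, hA, hh', hw, hpay⟩
  · obtain ⟨⟨hd1, hd2⟩, hg1, hg2⟩ := win_bounds H hB hx hy hk' h1 h2 hc hδ hδ4 hδ2 hC hp hle
    have hpos : 0 < pay B i r.price i + pay B i r.price (other i) := by
      rw [pay_other, pay_self, hy]; linarith
    have hsW : Secures a (b + 1) (pay B i r.price i) (pay B i r.price (other i)) := by
      rw [pay_other, pay_self, hx, hy]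
      right; push_cast; linarith
    have hwi := H.wins_ge _ hA i hpos a (b + 1) (by omega) hsW h' hh'
    have hge := H.payoff_ge _ hA i hpos a (b + 1) (by omega) hsW (by
        rw [pay_other, pay_self, hx, hy]; push_cast; linarith) h' hh'
    have hle := H.payoff_le _ hA i hpos a (b + 1) (by omega) (by
        rw [pay_other, pay_self, hx, hy]
        right; push_cast; linarith) (by
        rw [pay_other, pay_self, hx, hy]; push_cast; linarith) h' hh'
    rw [pay_other, pay_self, hx, hy] at hge hle
    have h3 := mul_le_mul_of_nonneg_left hd1 hc.le
    have h4 := mul_le_mul_of_nonneg_left hd2 hC.le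
    push_cast at hge hle ⊢
    exact ⟨by omega, by linarith, by linarith⟩
  · have hpo : r.price = crit v k B (other (other i)) := by rw [other_other, hp]
    obtain ⟨⟨hd1, hd2⟩, hg1, hg2⟩ := win_bounds H hB hy (by rw [other_other, hx])
      (show b + a + 1 = k by omega) h2 h1 hc hδ hδ4 hδ2 hC hpo (by rwa [other_other])
    have hpos : 0 < pay B (other i) r.price i + pay B (other i) r.price (other i) := by
      rw [pay_other_self, pay_self, hx]; linarith
    have hsW : Secures (a + 1) b (pay B (other i) r.price i)
        (pay B (other i) r.price (other i)) := by
      rw [pay_other_self, pay_self, hx, hy]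
      right; push_cast; linarith
    have hwi := H.wins_ge _ hA i hpos (a + 1) b (by omega) hsW h' hh'
    have hge := H.payoff_ge _ hA i hpos (a + 1) b (by omega) hsW (by
        rw [pay_other_self, pay_self, hx, hy]; push_cast; linarith) h' hh'
    have hle := H.payoff_le _ hA i hpos (a + 1) b (by omega) (by
        rw [pay_other_self, pay_self, hx, hy]
        right; push_cast; linarith) (by
        rw [pay_other_self, pay_self, hx, hy]; push_cast; linarith) h' hh'
    rw [pay_other_self, pay_self, hx, hy] at hge hle
    have h3 := mul_le_mul_of_nonneg_left hg1 hc.le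
    have h4 := mul_le_mul_of_nonneg_left hg2 hC.le
    push_cast at hge hle ⊢
    exact ⟨by omega, by linarith, by linarith⟩

/-! ### Budgets in a critical ratio -/

theorem SweepsExhausted.payoff_eq (hz : SweepsExhausted v k) (hB : Admissible v B)
    (hi : 0 < B i) (ho : B (other i) = 0) :
    ∀ h ∈ (canonicalOutcome v k B).support, payoff v B h i = v i * k + B i := by
  intro h hh
  rw [payoff_of_sweep v B i h, (play_basic k hB h hh).1]
  have := hz B hB (other i) ho (by rwa [other_other]) h hh
  rwa [other_other] at this

theorem crit_eq_of_ratio (H : PlayBounds v k c C) (hz : SweepsExhausted v k)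
    (hB : Admissible v B) {a b : ℕ} (hab : a + b = k) {s : ℝ} (hs : 0 < s)
    (h1 : B i = (a + 1) * s) (h2 : B (other i) = (b + 1) * s) (j : Fin 2) : crit v k B j = s := by
  have hz' : ∀ B, Admissible v B → ∀ i, 0 < B i → B (other i) = 0 →
      ∀ h ∈ (canonicalOutcome v k B).support, v i * k + B i ≤ payoff v B h i :=
    fun B hB i hi ho h hh => (hz.payoff_eq hB hi ho h hh).ge
  rcases eq_or_eq_other j i with rfl | rfl
  · exact crit_of_ratio H hz' hB hab hs h1 h2
  · exact crit_of_ratio H hz' hB (show b + a = k by omega) hs h2 (by rw [other_other, h1])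

/-- Either agent may win the tie at price s. Relative to the count a the excess is (k + 2) s,
relative to a + 1 it is 0; this explains the two payoff bounds. -/
theorem bounds_of_ratio (H : PlayBounds v k c C) (hz : SweepsExhausted v k)
    (hB : Admissible v B) {a b : ℕ} (hab : a + b = k) {s : ℝ} (hs : 0 < s)
    (h1 : B i = (a + 1) * s) (h2 : B (other i) = (b + 1) * s)
    (hc : 0 < c) (hc1 : c ≤ 1) (hδ1 : δ * (k + 2) ≤ 1 / 2) :
    ∀ h ∈ (canonicalOutcome v (k + 1) B).support, a ≤ wins h i ∧
      v i * a + δ * c * ((k + 2) * s) ≤ payoff v B h i ∧ payoff v B h i ≤ v i * (a + 1) := by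
  intro h hh
  have hk : (0 : ℝ) ≤ k := k.cast_nonneg
  have ha : (0 : ℝ) ≤ a := a.cast_nonneg
  have hb : (0 : ℝ) ≤ b := b.cast_nonneg
  have hkab : (k : ℝ) = a + b := by rw [← hab]; push_cast; ring
  have has : 0 ≤ a * s := by positivity
  have hbs : 0 ≤ b * s := by positivity
  have hcs : δ * c * ((k + 2) * s) ≤ c * s := by
    have : (δ * (k + 2)) * (c * s) ≤ 1 * (c * s) :=
      mul_le_mul_of_nonneg_right (by linarith) (by positivity)
    linarith
  have hv := (hB i).2
  rw [h1] at hv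
  obtain ⟨r, h', rfl, -, hcase⟩ := win_or_lose hB i hh
  rw [crit_eq_of_ratio H hz hB hab hs h1 h2, crit_eq_of_ratio H hz hB hab hs h1 h2] at hcase
  rcases hcase with ⟨-, hp, -, hpx, hA, hh', hw, hpay⟩ | ⟨-, hp, -, hpy, hA, hh', hw, hpay⟩
  · rw [hp] at hA hh' hpay
    have hx' : pay B i s i = a * s := by rw [pay_self, h1]; ring
    have hy' : pay B i s (other i) = (b + 1) * s := by rw [pay_other, h2]
    have hpos : 0 < pay B i s i + pay B i s (other i) := by rw [hx', hy']; linarith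
    have hle := H.payoff_le _ hA i hpos a b hab (by
      rw [hx', hy']; right; linarith) (by rw [hx', hy']; linarith) h' hh'
    rw [hx', hy'] at hle
    have hle' : payoff v B (r :: h') i ≤ v i * (a + 1) := by
      rw [hpay]
      refine (add_le_add le_rfl hle).trans_eq ?_
      ring
    cases a with
    | zero =>
      refine ⟨Nat.zero_le _, ?_, hle'⟩
      have h4 := (payoff_nonneg_le hA i h' hh').1
      have h5 : c * s ≤ 1 * s := mul_le_mul_of_nonneg_right hc1 hs.le
      push_cast at hv ⊢
      linarith
    | succ a =>
      have ha' : (0 : ℝ) ≤ a := a.cast_nonneg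
      push_cast at hx' hkab
      have hs' : Secures a (b + 1) (pay B i s i) (pay B i s (other i)) := by
        rw [hx', hy']; right; push_cast; nlinarith
      have hwi := H.wins_ge _ hA i hpos a (b + 1) (by omega) hs' h' hh'
      have hge := H.payoff_ge _ hA i hpos a (b + 1) (by omega) hs' (by
        rw [hx', hy']; push_cast; linarith) h' hh'
      rw [hx', hy'] at hge
      refine ⟨by omega, ?_, hle'⟩
      have h5 : 0 ≤ c * ((a + b + 1) * s) := by positivity
      push_cast at hge ⊢
      linarith
  · rw [hp] at hA hh' hpay
    have hx' : pay B (other i) s i = (a + 1) * s := by rw [pay_other_self, h1]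
    have hy' : pay B (other i) s (other i) = b * s := by rw [pay_self, h2]; ring
    have hpos : 0 < pay B (other i) s i + pay B (other i) s (other i) := by
      rw [hx', hy']; linarith
    have hs' : Secures a b (pay B (other i) s i) (pay B (other i) s (other i)) := by
      rw [hx', hy']; right; nlinarith
    have hwi := H.wins_ge _ hA i hpos a b hab hs' h' hh'
    have hge := H.payoff_ge _ hA i hpos a b hab hs' (by rw [hx', hy']; linarith) h' hh'
    rw [hx', hy'] at hge
    refine ⟨by omega, ?_, ?_⟩
    · have h5 : 0 ≤ c * ((a + b) * s) := by positivity
      linarith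
    · rw [hpay]
      cases b with
      -- The opponent has no money left; the bound follows from a = k and (a + 1) s < v i.
      | zero =>
        have h4 := (payoff_nonneg_le hA i h' hh').2
        rw [hx'] at h4
        rw [hkab] at h4
        push_cast at h4
        linarith
      | succ b =>
        push_cast at hy'
        have hb' : (0 : ℝ) ≤ b := b.cast_nonneg
        have hle := H.payoff_le _ hA i hpos (a + 1) b (by omega) (by
          rw [hx', hy']; right; push_cast; nlinarith) (by
          rw [hx', hy']; push_cast; linarith) h' hh'
        rw [hx', hy'] at hle
        push_cast at hle
        linarith

/-- Either the number of items that agent `i` wins is determined by the budgets, or the ratio of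
the budgets is critical. -/
theorem interior_or_ratio (hB : Admissible v B) (h0 : 0 < B i + B (other i)) (k : ℕ) :
    (∃ a b : ℕ, a + b = k + 1 ∧ Secures a b (B i) (B (other i)) ∧
      Secures b a (B (other i)) (B i)) ∨
    ∃ a b : ℕ, a + b = k ∧ ∃ s, 0 < s ∧ B i = (a + 1) * s ∧ B (other i) = (b + 1) * s := by
  classical
  -- Take the largest count a that agent i secures. If the opponent does not secure the rest, two
  -- weak inequalities meet in an equality, which is the wall.
  let P : ℕ → Prop := fun a => Secures a (k + 1 - a) (B i) (B (other i))
  have hP0 : P (Nat.findGreatest P (k + 1)) :=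
    Nat.findGreatest_spec (Nat.zero_le _) (show P 0 from .inl rfl)
  have hmax : ∀ n, Nat.findGreatest P (k + 1) < n → n ≤ k + 1 → ¬ P n :=
    fun n h1 h2 => Nat.findGreatest_is_greatest h1 h2
  have hle : Nat.findGreatest P (k + 1) ≤ k + 1 := Nat.findGreatest_le _
  generalize Nat.findGreatest P (k + 1) = a at hP0 hmax hle
  obtain ⟨b, hb⟩ := Nat.exists_eq_add_of_le hle
  have hPa : Secures a b (B i) (B (other i)) := by
    have : k + 1 - a = b := by omega
    rw [← this]; exact hP0
  by_cases hs : Secures b a (B (other i)) (B i)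
  · exact .inl ⟨a, b, hb.symm, hPa, hs⟩
  · obtain ⟨hb0, hs⟩ := not_or.1 hs
    obtain ⟨b, rfl⟩ := Nat.exists_eq_succ_of_ne_zero hb0
    have h1 : ¬ Secures (a + 1) b (B i) (B (other i)) := by
      have := hmax (a + 1) (by omega) (by omega)
      have h2 : k + 1 - (a + 1) = b := by omega
      rw [← h2]; exact this
    have h2 := (not_or.1 h1).2
    push_cast at hs h2
    have heq : (a + 1) * B (other i) = (b + 1) * B i := by
      linarith [not_lt.1 hs, not_lt.1 h2]
    have hx0 := (hB i).1
    have hy0 := (hB (other i)).1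
    have hxpos : 0 < B i := by
      refine hx0.lt_of_ne fun hx => ?_
      rw [← hx, mul_zero] at heq
      rcases mul_eq_zero.1 heq with h | h
      · linarith [(a.cast_nonneg : (0 : ℝ) ≤ a)]
      · linarith
    refine .inr ⟨a, b, by omega, B i / (a + 1), by positivity, by field_simp, ?_⟩
    field_simp
    linarith

theorem PlayBounds.succ (H : PlayBounds v k c C) (hz : SweepsExhausted v k)
    (hc : 0 < c) (hc1 : c ≤ 1) (hδ : 0 < δ) (hδ1 : δ * (k + 2) ≤ 1 / 2) (hδ2 : C * δ ≤ c / 2)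
    (hC : 0 < C) : PlayBounds v (k + 1) (δ * c) ((k + 1) * C) where
  wins_ge B hB i h0 a b hab hs h hh := by
    have hx0 := (hB i).1
    have hy0 := (hB (other i)).1
    rcases interior_or_ratio hB h0 k with
      ⟨a', b', hab', h1, h2⟩ | ⟨a', b', hab', s, hs0, h1, h2⟩
    · refine le_trans ?_ (bounds_of_interior H hB h0 hab' h1 h2 hc hδ hδ1 hδ2 hC h hh).1
      -- If a > a', then a y < (b + 1) x ≤ b' x < (a' + 1) y ≤ a y.
      by_contra hlt
      have h3 := hs.resolve_left (by omega)
      have h4 := h2.resolve_left (by omega)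
      have h5 : (a' : ℝ) + 1 ≤ a := by exact_mod_cast (by omega : a' + 1 ≤ a)
      have h6 : (b : ℝ) + 1 ≤ b' := by exact_mod_cast (by omega : b + 1 ≤ b')
      linarith [mul_le_mul_of_nonneg_right h5 hy0, mul_le_mul_of_nonneg_right h6 hx0]
    · refine le_trans ?_ (bounds_of_ratio H hz hB hab' hs0 h1 h2 hc hc1 hδ1 h hh).1
      by_contra hlt
      have h3 := hs.resolve_left (by omega)
      have h5 : (a' : ℝ) + 1 ≤ a := by exact_mod_cast (by omega : a' + 1 ≤ a)
      have h6 : (b : ℝ) ≤ b' := by exact_mod_cast (by omega : b ≤ b')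
      have h7 : (b + 1) * B i ≤ (b' + 1) * B i := by gcongr
      have h8 : (b' + 1) * B i = (a' + 1) * B (other i) := by rw [h1, h2]; ring
      linarith [mul_le_mul_of_nonneg_right h5 hy0]
  payoff_ge B hB i h0 a b hab hs hle h hh := by
    by_cases hs' : Secures b a (B (other i)) (B i)
    · exact (bounds_of_interior H hB h0 hab hs hs' hc hδ hδ1 hδ2 hC h hh).2.1
    · obtain ⟨hb0, hs'⟩ := not_or.1 hs'
      have heq := hle.antisymm (not_lt.1 hs')
      obtain ⟨b, rfl⟩ := Nat.exists_eq_succ_of_ne_zero hb0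
      push_cast at heq
      have ha : (0 : ℝ) ≤ a := a.cast_nonneg
      have hxpos : 0 < B i := by
        refine (hB i).1.lt_of_ne fun hx => ?_
        rw [← hx, mul_zero] at heq
        rcases mul_eq_zero.1 heq.symm with h | h <;> linarith
      have hk : (k : ℝ) = a + b := by exact_mod_cast (by omega : k = a + b)
      have hy : B (other i) = (b + 1) * (B i / (a + 1)) := by field_simp; linarith
      have := (bounds_of_ratio H hz hB (show a + b = k by omega) (s := B i / (a + 1))
        (by positivity) (by field_simp) hy hc hc1 hδ1 h hh).2.1
      refine Eq.trans_le ?_ this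
      rw [hy, hk]
      push_cast
      field_simp
      ring
  payoff_le B hB i h0 a b hab hs hle h hh := by
    by_cases hs' : Secures a b (B i) (B (other i))
    · exact (bounds_of_interior H hB h0 hab hs' hs hc hδ hδ1 hδ2 hC h hh).2.2
    · obtain ⟨ha0, hs'⟩ := not_or.1 hs'
      have heq := hle.antisymm (not_lt.1 hs')
      obtain ⟨a, rfl⟩ := Nat.exists_eq_succ_of_ne_zero ha0
      push_cast at heq
      have hxpos : 0 < B i := by
        refine (hB i).1.lt_of_ne fun hx => ?_
        rw [← hx, mul_zero] at heq
        rcases mul_eq_zero.1 heq with h | h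
        · linarith [(a.cast_nonneg : (0 : ℝ) ≤ a)]
        · linarith
      have hy : B (other i) = (b + 1) * (B i / (a + 1)) := by field_simp; linarith
      have := (bounds_of_ratio H hz hB (show a + b = k by omega) (s := B i / (a + 1))
        (by positivity) (by field_simp) hy hc hc1 hδ1 h hh).2.2
      push_cast
      rw [heq]
      linarith

end

theorem exists_playBounds (v : Fin 2 → ℝ) (k : ℕ) :
    ∃ c C, (0 < c ∧ c ≤ 1 ∧ 1 ≤ C) ∧ PlayBounds v k c C ∧ SweepsExhausted v k := by
  induction k with
  | zero =>
    have hnil : ∀ B h, h ∈ (canonicalOutcome v 0 B).support → h = [] := fun B h hh => by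
      simpa [canonicalOutcome] using hh
    refine ⟨1, 1, by norm_num, ⟨?_, ?_, ?_⟩, ?_⟩
    · intro B hB i h0 a b hab hs h hh
      omega
    · intro B hB i h0 a b hab hs hle h hh
      obtain ⟨rfl, rfl⟩ : a = 0 ∧ b = 0 := by omega
      rw [hnil B h hh]
      simp [payoff, remaining]
    · intro B hB i h0 a b hab hs hle h hh
      obtain ⟨rfl, rfl⟩ : a = 0 ∧ b = 0 := by omega
      rw [hnil B h hh]
      simp [payoff, remaining]
    · intro B hB i hi ho h hh r hr
      rw [hnil B h hh] at hr
      simp at hr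
  | succ k ih =>
    obtain ⟨c, C, ⟨hc, hc1, hC⟩, H, hz⟩ := ih
    have hk : (0 : ℝ) ≤ k := k.cast_nonneg
    -- This δ meets both δ (k + 2) ≤ 1 / 2, as c ≤ 1 ≤ C, and C δ ≤ c / 2.
    have hδ1 : c / (2 * (k + 2) * C) * (k + 2) = c / C / 2 := by field_simp
    have hδ2 : C * (c / (2 * (k + 2) * C)) = c / 2 / (k + 2) := by field_simp
    have h1 : c / C ≤ 1 := div_le_one_of_le₀ (hc1.trans hC) (by linarith)
    have hδ3 : c / (2 * (k + 2) * C) ≤ 1 := by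
      refine div_le_one_of_le₀ ?_ (by positivity)
      nlinarith
    refine ⟨_, _, ⟨?_, ?_, ?_⟩, H.succ hz hc hc1 (δ := c / (2 * (k + 2) * C)) (by positivity)
      (by rw [hδ1]; linarith) (by rw [hδ2]; exact div_le_self (by positivity) (by linarith))
      (by positivity), H.sweeps_succ hz⟩
    · positivity
    · exact mul_le_one₀ hδ3 hc.le hc1
    · nlinarith

/-! ### Plays at the constant price -/

theorem plays_of_ratio (v : Fin 2 → ℝ) {s : ℝ} (hs : 0 < s) (k : ℕ) :
    ∀ (B : Fin 2 → ℝ) (m n : ℕ), Admissible v B → m + n = k + 1 → B 0 = m * s → B 1 = n * s →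
      ∀ h ∈ (canonicalOutcome v k B).support, ∃ h₁ h₂ : List Round, h = h₁ ++ h₂ ∧
        (∀ t < h₁.length, ∀ i, 0 < remaining B (h₁.take t) i) ∧
        (∀ r ∈ h₁, ∀ i, r.bids i = ⟨s, false⟩) ∧
        ∃ i, remaining B h₁ i = 0 ∧ ∀ r ∈ h₂, r.winner = other i ∧ r.price = 0 := by
  induction k with
  | zero =>
    intro B m n hB hmn h0 h1 h hh
    have hnil : h = [] := by simpa [canonicalOutcome] using hh
    refine ⟨[], [], by simp [hnil], by simp, by simp, ?_⟩
    -- With no item left a single unit of s remains, so one budget is 0.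
    obtain ⟨rfl, rfl⟩ | ⟨rfl, rfl⟩ : m = 0 ∧ n = 1 ∨ m = 1 ∧ n = 0 := by omega
    · exact ⟨0, by simp [remaining, h0], by simp⟩
    · exact ⟨1, by simp [remaining, h1], by simp⟩
  | succ k ih =>
    intro B m n hB hmn h0 h1 h hh
    obtain ⟨-, -, -, -, hz⟩ := exists_playBounds v (k + 1)
    rcases Nat.eq_zero_or_pos m with rfl | hm
    · have hi : B 0 = 0 := by simpa using h0
      have hn : (0 : ℝ) < n := by exact_mod_cast (by omega : 0 < n)
      have ho : 0 < B (other 0) := by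
        change 0 < B 1
        rw [h1]; positivity
      exact ⟨[], h, rfl, by simp, by simp, 0, hi, hz B hB 0 hi ho h hh⟩
    rcases Nat.eq_zero_or_pos n with rfl | hn
    · have hi : B 1 = 0 := by simpa using h1
      have hm : (0 : ℝ) < m := by exact_mod_cast hm
      have ho : 0 < B (other 1) := by
        change 0 < B 0
        rw [h0]; positivity
      exact ⟨[], h, rfl, by simp, by simp, 1, hi, hz B hB 1 hi ho h hh⟩
    obtain ⟨a, rfl⟩ := Nat.exists_eq_succ_of_ne_zero hm.ne'
    obtain ⟨b, rfl⟩ := Nat.exists_eq_succ_of_ne_zero hn.ne'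
    obtain ⟨c, C, -, H, hz⟩ := exists_playBounds v k
    have hcrit : ∀ j, crit v k B j = s :=
      crit_eq_of_ratio (i := 0) H hz hB (show a + b = k by omega) hs (by rw [h0]; push_cast; rfl)
        (by change B 1 = _; rw [h1]; push_cast; rfl)
    obtain ⟨r, h', rfl, hb, hp, -, -, -, hA, hh'⟩ := cons_of_mem_support hB hh
    rw [hcrit] at hp
    -- The payment removes one unit of s from the winner, along with one item, so the invariant m +
    -- n = k + 1 persists.
    have hnext : ∃ m' n' : ℕ, m' + n' = k + 1 ∧ pay B r.winner r.price 0 = m' * s ∧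
        pay B r.winner r.price 1 = n' * s := by
      rw [hp]
      rcases eq_or_eq_other r.winner 0 with hw | hw
      · refine ⟨a, b + 1, by omega, ?_, ?_⟩
        · rw [hw, pay_self, h0]; push_cast; ring
        · rw [hw, show (1 : Fin 2) = other 0 from rfl, pay_other]; exact h1
      · refine ⟨a + 1, b, by omega, ?_, ?_⟩
        · rw [hw, pay_other_self]; exact h0
        · rw [hw, show other 0 = (1 : Fin 2) from rfl, pay_self, h1]; push_cast; ring
    obtain ⟨m', n', hmn', h0', h1'⟩ := hnext
    obtain ⟨h₁, h₂, rfl, hpos, hbid, i, hi, hsw⟩ := ih _ m' n' hA hmn' h0' h1' h' hh'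
    refine ⟨r :: h₁, h₂, rfl, ?_, ?_, i, hi, hsw⟩
    · intro t ht j
      cases t with
      | zero =>
        change 0 < B j
        fin_cases j
        · change 0 < B 0
          rw [h0]; positivity
        · change 0 < B 1
          rw [h1]; positivity
      | succ t => exact hpos t (by simpa using ht) j
    · intro r' hr' j
      rcases List.mem_cons.1 hr' with rfl | hr'
      · rw [hb]
        simp [canonicalBids, hcrit]
      · exact hbid r' hr' j

end SeqAuction

theorem mainTheorem8 (k k₁ k₂ : ℕ) (hk : k₁ + k₂ = k) (B v : Fin 2 → ℝ)
    (hB₁ : 0 ≤ B 0) (hB₂ : 0 < B 1) (hv : ∀ i j, 2 ^ k * B j < v i)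
    (hratio : B 0 / B 1 = (k₁ : ℝ) / ((k₂ : ℝ) + 1)) :
    ∃ p : ℝ, p = B 1 / ((k₂ : ℝ) + 1) ∧ (k₁ ≠ 0 → p = B 0 / (k₁ : ℝ)) ∧
      ∀ h ∈ (SeqAuction.canonicalOutcome v k B).support,
        h.length = k ∧
        ∃ h₁ h₂ : List SeqAuction.Round, h = h₁ ++ h₂ ∧
          (∀ t < h₁.length, ∀ i, 0 < SeqAuction.remaining B (h₁.take t) i) ∧
          (∀ r ∈ h₁, ∀ i, r.bids i = ⟨p, false⟩) ∧
          ∃ i, SeqAuction.remaining B h₁ i = 0 ∧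
            ∀ r ∈ h₂, r.winner = SeqAuction.other i ∧ r.price = 0 := by
  have hk2 : (0 : ℝ) < (k₂ : ℝ) + 1 := by positivity
  have hB : SeqAuction.Admissible v B := by
    have hnn : ∀ i, 0 ≤ B i := by
      intro i
      fin_cases i
      · exact hB₁
      · exact hB₂.le
    intro i
    refine ⟨hnn i, lt_of_le_of_lt ?_ (hv i i)⟩
    exact le_mul_of_one_le_left (hnn i) (one_le_pow₀ (by norm_num))
  have h0 : B 0 = k₁ * (B 1 / ((k₂ : ℝ) + 1)) := by
    rw [div_eq_div_iff hB₂.ne' hk2.ne'] at hratio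
    field_simp
    linarith
  have h1 : B 1 = ((k₂ + 1 : ℕ) : ℝ) * (B 1 / ((k₂ : ℝ) + 1)) := by
    push_cast
    field_simp
  refine ⟨_, rfl, fun hk1 => ?_, fun h hh => ⟨(SeqAuction.play_basic k hB h hh).1, ?_⟩⟩
  · have : (k₁ : ℝ) ≠ 0 := by exact_mod_cast hk1
    rw [h0]
    field_simp
  -- In units of p* the budgets are k₁ and k₂ + 1, one unit more than the number of items.
  · exact SeqAuction.plays_of_ratio v (by positivity) k B k₁ (k₂ + 1) hB (by omega) h0 h1 h hh
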